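/- Let $\mathcal A$ be a unital $C^*$-algebra and let $H_{\mathcal A}$ be the standard Hilbert module over $\mathcal A$, i.e. the (left) $\mathcal A$-module of all sequences $x=(x_i)_{i\ge 0}$ in $\mathcal A$ for which $\sum_i x_i x_i^*$ converges in norm, with inner product $\langle x,y\rangle=\sum_i y_i x_i^*$ and norm $\|x\|=\|\langle x,x\rangle\|^{1/2}$. A submodule is called finitely generated if it is the linear span over $\mathcal A$ of a finite subset, and $\tilde\oplus$ denotes a direct sum of closed submodules that need not be orthogonal. For a bounded $\mathcal A$-linear operator $F:H_{\mathcal A}\to H_{\mathcal A}$, say that a pair of decompositions $$H_{\mathcal A}=M_1\tilde\oplus N_1\ \xrightarrow{\;F\;}\ M_2\tilde\oplus N_2=H_{\mathcal A}$$ into closed submodules diagonalizes $F$ if $F(M_1)\subseteq M_2$, $F(N_1)\subseteq N_2$ and $F|_{M_1}:M_1\to M_2$ is an isomorphism, i.e. an $\mathcal A$-linear bijection that is bounded together with its inverse; in other words, $F$ has the matrix $\begin{bmatrix}F_1&0\\0&F_4\end{bmatrix}$ with $F_1$ an isomorphism. The operator $F$ is $\mathcal A$-Fredholm if it is adjointable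 and is diagonalized by some such pair in which $N_1$ and $N_2$ are finitely generated. **Lemma.** Let $F$ be an $\mathcal A$-Fredholm operator on $H_{\mathcal A}$, and let $$H_{\mathcal A}=M_1\tilde\oplus N_1\ \xrightarrow{\;F\;}\ M_2\tilde\oplus N_2=H_{\mathcal A},\qquad H_{\mathcal A}=M_1'\tilde\oplus N_1'\ \xrightarrow{\;F\;}\ M_2'\tilde\oplus N_2'=H_{\mathcal A}$$ be two pairs of decompositions into closed submodules that diagonalize $F$. Suppose that $N_1$, $N_1'$ and $N_2$ are finitely generated (while $N_2'$ is only assumed to be closed). Then $N_2'$ is finitely generated. -/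

import Mathlib

/-! ### The standard Hilbert module `H_A`

Hilbert modules are used in Mathlib's convention (`CStarModule`): left modules, with an `A`-valued
inner product that is linear in the second variable. -/

section StandardModule

variable {A : Type*} [CStarAlgebra A] [PartialOrder A] [StarOrderedRing A]

theorem summable_of_nonneg_of_le_cstar {f g : ℕ → A} (hf : ∀ i, 0 ≤ f i) (hfg : ∀ i, f i ≤ g i)
    (hg : Summable g) : Summable f := by
  rw [summable_iff_vanishing_norm] at hg ⊢
  intro ε hε
  obtain ⟨s, hs⟩ := hg ε hε
  refine ⟨s, fun t ht => lt_of_le_of_lt ?_ (hs t ht)⟩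
  exact CStarAlgebra.norm_le_norm_of_nonneg_of_le (Finset.sum_nonneg fun i _ => hf i)
    (Finset.sum_le_sum fun i _ => hfg i)

theorem add_mul_star_add_le (a b : A) :
    (a + b) * star (a + b) ≤ (2 : ℕ) • (a * star a) + (2 : ℕ) • (b * star b) := by
  have h : 0 ≤ (a - b) * star (a - b) := mul_star_self_nonneg _
  have h2 : (2 : ℕ) • (a * star a) + (2 : ℕ) • (b * star b)
      = (a + b) * star (a + b) + (a - b) * star (a - b) := by
    simp only [star_add, star_sub]
    noncomm_ring
  rw [h2]
  exact le_add_of_nonneg_right h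

variable (A) in
/-- The `A`-module of all sequences `(x₀, x₁, …)` in `A` for which `∑ xᵢ xᵢ*` converges in norm
(for a series of positive elements of a C⋆-algebra, norm convergence of the partial sums
is the same as `Summable`). -/
def stdSeq : Submodule A (ℕ → A) where
  carrier := {x | Summable fun i => x i * star (x i)}
  zero_mem' := by simp [summable_zero]
  add_mem' {x y} hx hy :=
    summable_of_nonneg_of_le_cstar (fun i => mul_star_self_nonneg _)
      (fun i => add_mul_star_add_le (x i) (y i))
      ((hx.const_smul (2 : ℕ)).add (hy.const_smul (2 : ℕ)))
  smul_mem' a x hx := by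
    have h := (hx.mul_left a).mul_right (star a)
    have e : (fun i => (a • x) i * star ((a • x) i))
        = fun i => a * (x i * star (x i)) * star a := by
      funext i
      simp [mul_assoc]
    change Summable fun i => (a • x) i * star ((a • x) i)
    rw [e]
    simpa only [mul_assoc] using h

variable (A) in
/-- The standard Hilbert module `H_A = ℓ²(A)` over the C⋆-algebra `A`. -/
def StdModule : Type _ := stdSeq A

namespace StdModule

instance : AddCommGroup (StdModule A) := inferInstanceAs (AddCommGroup (stdSeq A))
instance : Module A (StdModule A) := inferInstanceAs (Module A (stdSeq A))
noncomputable instance : Module ℂ (StdModule A) := inferInstanceAs (Module ℂ (stdSeq A))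
instance : IsScalarTower ℂ A (StdModule A) := inferInstanceAs (IsScalarTower ℂ A (stdSeq A))

/-- The entries of an element of `H_A`. -/
instance : CoeFun (StdModule A) fun _ => ℕ → A := ⟨fun x => x.1⟩

@[ext] theorem ext {x y : StdModule A} (h : ∀ i, x i = y i) : x = y := Subtype.ext (funext h)

@[simp] theorem add_apply (x y : StdModule A) (i : ℕ) : (x + y) i = x i + y i := rfl
@[simp] theorem zero_apply (i : ℕ) : (0 : StdModule A) i = 0 := rfl
@[simp] theorem smul_apply (a : A) (x : StdModule A) (i : ℕ) : (a • x) i = a * x i := rfl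
@[simp] theorem complex_smul_apply (z : ℂ) (x : StdModule A) (i : ℕ) : (z • x) i = z • x i := rfl

theorem summable_self (x : StdModule A) : Summable fun i => x i * star (x i) := x.2

theorem summable_inner (x y : StdModule A) : Summable fun i => y i * star (x i) := by
  have h := (((summable_self (y + x)).add
    ((summable_self (y + Complex.I • x)).const_smul Complex.I)).add
    ((summable_self (y + (-1 : ℂ) • x)).const_smul (-1 : ℂ))).add
    ((summable_self (y + (-Complex.I) • x)).const_smul (-Complex.I))
  have h4 := h.const_smul (4⁻¹ : ℂ)
  refine h4.congr fun i => ?_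
  simp only [add_apply, complex_smul_apply, star_add, star_smul, RCLike.star_def,
    Complex.conj_I, map_neg, map_one, mul_add, add_mul, smul_mul_assoc, mul_smul_comm, smul_add,
    smul_smul]
  match_scalars <;> ring_nf <;> simp [Complex.I_sq]; norm_num

/-- The inner product `⟪x, y⟫ = ∑ yᵢ xᵢ*`. -/
noncomputable instance : Inner A (StdModule A) := ⟨fun x y => ∑' i, y i * star (x i)⟩

theorem inner_def (x y : StdModule A) : inner A x y = ∑' i, y i * star (x i) := rfl

/-- The norm `‖x‖ = ‖⟪x, x⟫‖^(1/2)`. -/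
noncomputable instance : Norm (StdModule A) := ⟨fun x => √‖(inner A x x : A)‖⟩

noncomputable instance : CStarModule A (StdModule A) where
  inner_add_right {x y z} := by
    simp only [inner_def, add_apply, add_mul]
    exact (summable_inner x y).tsum_add (summable_inner x z)
  inner_self_nonneg := tsum_nonneg fun _ => mul_star_self_nonneg _
  inner_self {x} := by
    refine ⟨fun h => ?_, fun h => by simp [h, inner_def]⟩
    have h0 := ((summable_self x).hasSum_iff.2 h)
    rw [hasSum_zero_iff_of_nonneg fun _ => mul_star_self_nonneg _] at h0
    ext i
    exact (CStarRing.mul_star_self_eq_zero_iff _).1 (congrFun h0 i)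
  inner_op_smul_right {a x y} := by
    simp only [inner_def, smul_apply, mul_assoc]
    exact (summable_inner x y).tsum_mul_left a
  inner_smul_right_complex {z x y} := by
    simp only [inner_def, complex_smul_apply, smul_mul_assoc]
    exact (summable_inner x y).tsum_const_smul z
  star_inner x y := by
    simp only [inner_def, tsum_star, star_mul, star_star]
  norm_eq_sqrt_norm_inner_self _ := rfl

noncomputable instance : NormedAddCommGroup (StdModule A) := CStarModule.normedAddCommGroup A

noncomputable instance : NormedSpace ℂ (StdModule A) :=
  NormedSpace.ofCore (CStarModule.normedSpaceCore A)

end StdModule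

/-! ### Fredholm operators on `H_A` -/

/-- The bounded `A`-linear operator `F` on `H_A` is adjointable. -/
def IsAdjointable (F : StdModule A →L[A] StdModule A) : Prop :=
  ∃ G : StdModule A →L[A] StdModule A, ∀ x y, (inner A (F x) y : A) = inner A x (G y)

/-- `H_A = M₁ ⊕̃ N₁ → M₂ ⊕̃ N₂ = H_A` is a pair of decompositions into (not necessarily orthogonal)
topological direct sums of closed submodules, with respect to which `F` has a diagonal matrix
`diag(F₁, F₄)` where `F₁ : M₁ → M₂` is an isomorphism, that is, an `A`-linear bijection which is
bounded together with its inverse. -/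
structure IsDiagonalizing (F : StdModule A →L[A] StdModule A)
    (M₁ N₁ M₂ N₂ : Submodule A (StdModule A)) : Prop where
  isClosed_M₁ : IsClosed (M₁ : Set (StdModule A))
  isClosed_N₁ : IsClosed (N₁ : Set (StdModule A))
  isClosed_M₂ : IsClosed (M₂ : Set (StdModule A))
  isClosed_N₂ : IsClosed (N₂ : Set (StdModule A))
  domain_isCompl : IsCompl M₁ N₁
  codomain_isCompl : IsCompl M₂ N₂
  mapsTo_N : ∀ x ∈ N₁, F x ∈ N₂
  iso : ∃ F₁ : M₁ ≃L[A] M₂, ∀ x : M₁, (F₁ x : StdModule A) = F x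

/-- `F` is `A`-Fredholm: it is adjointable and it is diagonalized by a pair of decompositions in
which both `N₁` and `N₂` are finitely generated. As `A` is unital, the span of a set over `ℂ` and
`A` is its `A`-span, so this is `Submodule.FG`. -/
def IsAFredholm (F : StdModule A →L[A] StdModule A) : Prop :=
  IsAdjointable F ∧ ∃ M₁ N₁ M₂ N₂ : Submodule A (StdModule A),
    IsDiagonalizing F M₁ N₁ M₂ N₂ ∧ N₁.FG ∧ N₂.FG

end StandardModule

/-! The complement `N₂'` is isomorphic to the quotient of `H_A` by `M₂'`, so it suffices to find a
finitely generated `K` with `M₂' + K = H_A`. The range of `F` links the two decompositions: it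
contains `M₂` and lies in `M₂' + F(N₁')`. Hence `H_A = M₂ + N₂ ⊆ M₂' + F(N₁') + N₂`, and `K = F(N₁')
+ N₂` works. -/

/-- If `M ⊕ N` is the whole module and a finitely generated submodule together with `M` spans it,
then `N` is finitely generated. -/
theorem Submodule.FG.of_isCompl_of_sup_eq_top {R E : Type*} [Ring R] [AddCommGroup E] [Module R E]
    {M N K : Submodule R E} (hMN : IsCompl M N) (hK : K.FG) (hMK : M ⊔ K = ⊤) : N.FG := by
  have e := Submodule.quotientEquivOfIsCompl M N hMN
  -- Passing to the quotient kills `M`, so the image of `K` is the image of `M ⊔ K = ⊤`.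
  have hmap : K.map M.mkQ = ⊤ := by
    rw [← Submodule.range_mkQ M, LinearMap.range_eq_map, ← hMK, Submodule.map_sup,
      Submodule.mkQ_map_self, bot_sup_eq]
  have : Module.Finite R (E ⧸ M) := ⟨hmap ▸ hK.map M.mkQ⟩
  exact Module.Finite.iff_fg.1 (Module.Finite.equiv e)

/-- The range of a diagonalized operator contains `M₂`. -/
theorem IsDiagonalizing.le_range {A : Type*} [CStarAlgebra A] [PartialOrder A] [StarOrderedRing A]
    {F : StdModule A →L[A] StdModule A} {M₁ N₁ M₂ N₂ : Submodule A (StdModule A)}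
    (h : IsDiagonalizing F M₁ N₁ M₂ N₂) : M₂ ≤ LinearMap.range F.toLinearMap := by
  obtain ⟨F₁, hF₁⟩ := h.iso
  intro y hy
  exact ⟨F₁.symm ⟨y, hy⟩, by simpa using (hF₁ (F₁.symm ⟨y, hy⟩)).symm⟩

/-- The range of a diagonalized operator is contained in `M₂ ⊔ F(N₁)`. -/
theorem IsDiagonalizing.range_le {A : Type*} [CStarAlgebra A] [PartialOrder A] [StarOrderedRing A]
    {F : StdModule A →L[A] StdModule A} {M₁ N₁ M₂ N₂ : Submodule A (StdModule A)}
    (h : IsDiagonalizing F M₁ N₁ M₂ N₂) :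
    LinearMap.range F.toLinearMap ≤ M₂ ⊔ N₁.map F.toLinearMap := by
  obtain ⟨F₁, hF₁⟩ := h.iso
  -- The summand `F(N₁)` is kept, not enlarged to `N₂`: it inherits finite generation from `N₁`,
  -- whatever `N₂` is.
  rw [LinearMap.range_eq_map, ← h.domain_isCompl.sup_eq_top, Submodule.map_sup]
  refine sup_le_sup_right ?_ _
  rintro _ ⟨x, hx, rfl⟩
  have hx' := (F₁ ⟨x, hx⟩).2
  rwa [hF₁] at hx'

theorem lemma2p16 {A : Type*} [CStarAlgebra A] [PartialOrder A] [StarOrderedRing A]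
    (F : StdModule A →L[A] StdModule A) (hF : IsAFredholm F)
    (M₁ N₁ M₂ N₂ M₁' N₁' M₂' N₂' : Submodule A (StdModule A))
    (h : IsDiagonalizing F M₁ N₁ M₂ N₂)
    (h' : IsDiagonalizing F M₁' N₁' M₂' N₂')
    (hN₁ : N₁.FG) (hN₁' : N₁'.FG) (hN₂ : N₂.FG) :
    N₂'.FG := by
  refine Submodule.FG.of_isCompl_of_sup_eq_top h'.codomain_isCompl
    ((hN₁'.map F.toLinearMap).sup hN₂) ?_
  -- Regrouped as `(M₂' ⊔ F(N₁')) ⊔ N₂`, the sum is compared with `M₂ ⊔ N₂ = ⊤`; only `M₂ ≤ M₂' ⊔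
  -- F(N₁')` remains, through the range of `F`.
  rw [← sup_assoc, eq_top_iff, ← h.codomain_isCompl.sup_eq_top]
  exact sup_le_sup_right (h.le_range.trans h'.range_le) _
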